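/- Definitions. The dartboard is the unit square $[0,1]^2$, partitioned into a finite set $\mathcal C$ of measurable cells; the size $p_i$ of a cell is its area. A dartboard sketch has a state space of subsets of $\mathcal C$ (the set of occupied cells), an initial state, and a transition function giving the next state when a dart hits a cell, such that (R1) a cell that contains a dart is occupied, (R2) a dart hitting an occupied cell does not change the state, and (R3) an occupied cell never becomes free. The sketch is linearizable if there are an enumeration $c_0,\dots,c_{|\mathcal C|-1}$ of the cells and a function $\phi:\{0,1\}^*\to\{0,1\}$, monotone on words of each length, such that after every finite sequence of darts $Y_i=Z_i\vee\phi(Y_0,\dots,Y_{i-1})$ for all $i$, where $Z_i$ indicates that $c_i$ has been hit by a dart and $Y_i$ that $c_i$ is occupied. At time $\lambda>0$, $\mathrm{Poisson}(\lambda)$ independent uniform darts have been thrown; $\mathbf Y_{[\lambda]}=(Y_0,\dots,Y_{|\mathcal C|-1})$ is the resulting random state and $f_\lambda$ its probability mass function. Let $H(\mathbf Y_{[\lambda]})=\mathbb E[-\log_2 f_\lambda(\mathbf Y_{[\lambda]})]$ be its Shannon entropy and $I_{\mathbf Y}(\lambda)=\mathbb E\big[\big(\tfrac{\partial}{\partial\lambda}f_\lambda(\mathbf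 Y_{[\lambda]})/f_\lambda(\mathbf Y_{[\lambda]})\big)^2\big]$ its Fisher information. Put $h(x)=-x\ln x-(1-x)\ln(1-x)$ and $$H_0=\frac1{\ln 2}\int_{-\infty}^{\infty}h\big(e^{-e^w}\big)\,dw,\qquad I_0=\int_{-\infty}^\infty\frac{e^{2w}}{e^{e^w}-1}\,dw,$$ $$\rho(d)=1-\max\big(8d^{-1/4},5e^{-d/2}\big),\qquad D(d)=1+\frac{344+4\sqrt d}{d}\cdot\frac{H_0}{I_0}\,\rho(d).$$ Theorem. Let $a<b$ be reals with $d=b-a>1$ and $D(d)>0$ (which holds for all $d\ge 4096$), and let $\tilde H,\tilde I>0$. If a linearizable dartboard sketch satisfies - $H(\mathbf Y_{[\lambda]})\le\tilde H$ for all $\lambda>0$, and - $\lambda^2 I_{\mathbf Y}(\lambda)\ge\tilde I$ for all $\lambda\in[e^a,e^b]$, then $$\frac{\tilde H}{\tilde I}\;\ge\;\frac{H_0}{I_0}\cdot\frac{\rho(d)}{D(d)}.$$ Moreover, the right-hand side equals $(1-\varepsilon(d))\,H_0/I_0$ for a function $\varepsilon$ with $\varepsilon(d)\to0$ as $d\to\infty$.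 -/

import Mathlib

open scoped BigOperators

noncomputable section

/-- The unit square `[0,1]²`, with Lebesgue measure (a probability measure) as `volume`. -/
abbrev Dartboard : Type := unitInterval × unitInterval

/-- A dartboard sketch with set of cells `C`.  The partition of the unit square into cells is given
by the map `cellOf` sending a point to the cell that contains it.  A state is identified with its
set of occupied cells, and `step σ c` is the state reached from `σ` when a dart hits cell `c`. -/
structure DartboardSketch (C : Type*) where
  /-- the cell containing a given point of the dartboard -/
  cellOf : Dartboard → C
  measurableSet_cell : ∀ c, MeasurableSet (cellOf ⁻¹' {c})
  /-- the state space -/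
  states : Set (Finset C)
  /-- the state before any dart is thrown -/
  init : Finset C
  init_mem : init ∈ states
  /-- the transition function -/
  step : Finset C → C → Finset C
  step_mem : ∀ σ ∈ states, ∀ c, step σ c ∈ states
  /-- (R1) every cell containing a dart is occupied -/
  mem_step : ∀ σ ∈ states, ∀ c, c ∈ step σ c
  /-- (R2) a dart hitting an occupied cell does not change the state -/
  step_of_mem : ∀ σ ∈ states, ∀ c ∈ σ, step σ c = σ
  /-- (R3) an occupied cell never becomes free -/
  subset_step : ∀ σ ∈ states, ∀ c, σ ⊆ step σ c

namespace DartboardSketch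

variable {C : Type*}

/-- The state reached after throwing the darts `x 0, …, x (k-1)` in this order. -/
def stateAfter (S : DartboardSketch C) {k : ℕ} (x : Fin k → Dartboard) : Finset C :=
  (List.ofFn fun j => S.cellOf (x j)).foldl S.step S.init

open scoped Classical in
/-- `S` is linearizable: there are an enumeration `c 0, c 1, …, c (|C|-1)` of the cells and a
monotone `φ : {0,1}* → {0,1}` (given by its restrictions `φ i` to words of length `i`) such that
always `Y i = Z i ∨ φ (Y 0, …, Y (i-1))`, where `Z i` says whether `c i` has been hit by a dart
and `Y i` whether `c i` is occupied. -/
def IsLinearizable [Fintype C] (S : DartboardSketch C) : Prop :=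
  ∃ (c : Fin (Fintype.card C) ≃ C) (φ : (i : ℕ) → (Fin i → Bool) → Bool),
    (∀ i, Monotone (φ i)) ∧
    ∀ (k : ℕ) (x : Fin k → Dartboard) (i : Fin (Fintype.card C)),
      c i ∈ S.stateAfter x ↔
        (∃ j, S.cellOf (x j) = c i) ∨
          φ i (fun j => decide (c (j.castLE i.isLt.le) ∈ S.stateAfter x)) = true

/-- The probability that the Poissonized sketch is in state `σ` at time (cardinality) `t`, when
`Poisson(t)` independent uniform darts have been thrown. -/
def stateProb (S : DartboardSketch C) (t : ℝ) (σ : Finset C) : ℝ :=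
  ∑' k : ℕ, Real.exp (-t) * t ^ k / (k.factorial : ℝ) *
    (MeasureTheory.volume {x : Fin k → Dartboard | S.stateAfter x = σ}).toReal

end DartboardSketch

/-- Shannon entropy (in bits) `𝔼[-log₂ f(X)]` of a random variable `X` with mass function `f`. -/
def shannonEntropy {α : Type*} [Fintype α] (f : α → ℝ) : ℝ :=
  ∑ x, f x * -Real.logb 2 (f x)

/-- Fisher information `𝔼[((∂/∂t) f_t(X) / f_t(X))²]` at the parameter `t` of a random variable `X`
with mass function `f t`. -/
def fisherInformation {α : Type*} [Fintype α] (f : ℝ → α → ℝ) (t : ℝ) : ℝ :=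
  ∑ x, f t x * (deriv (fun s => f s x) t / f t x) ^ 2

/-- Entropy in nats of a Bernoulli variable. -/
def hNat (x : ℝ) : ℝ := -x * Real.log x - (1 - x) * Real.log (1 - x)

/-- The constant `H₀`. -/
def H₀ : ℝ := 1 / Real.log 2 * ∫ w : ℝ, hNat (Real.exp (-Real.exp w))

/-- The constant `I₀`, the integral over `w ∈ ℝ` of `g(e^w)` with `g(x) = x² / (e^x - 1)`. -/
def I₀ : ℝ := ∫ w : ℝ, Real.exp w ^ 2 / (Real.exp (Real.exp w) - 1)

/-- `1 - max(8 d^{-1/4}, 5 e^{-d/2})`. -/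
def lossFactor (d : ℝ) : ℝ :=
  1 - max (8 * d ^ (-(1 / 4) : ℝ)) (5 * Real.exp (-d / 2))

/-- The denominator `1 + ((344 + 4√d)/d) (H₀/I₀) (1 - max(8 d^{-1/4}, 5 e^{-d/2}))`. -/
def lossDenominator (d : ℝ) : ℝ :=
  1 + (344 + 4 * Real.sqrt d) / d * (H₀ / I₀) * lossFactor d

end

/-! Linearizability makes the state a word generated from left to right: bit `i` is either forced by
its predecessors or an independent Bernoulli variable with zero-probability `exp (-p i * t)`. The
chain rules (`sum_negMulLog_wordProb`, `fisherInformation_wordProb`) therefore write entropy and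
Fisher information as sums over cells with the same weights, the probabilities that a cell is not
forced. Since `φ` is monotone, these weights decrease in time (`freeProb_le_of_le`).

In logarithmic time `x = log t`, a cell of area `p` contributes the fixed profiles `entropyDensity`
and `t ^ 2`-scaled `fisherDensity`, translated by `log p`. The ratio of the profiles is decreasing,
so entropy minus `c` times Fisher information changes sign at most once, from plus to minus, and a
decreasing weight can only help the entropy (`integral_antitone_mul_le`). It remains to compare
unweighted tails. There the constant `H₀ / I₀` is nearly attained once the entropy window is
extended to the left by `D` (`integral_fisherDensity_Ioi_le`).

Integrating the hypotheses over `[a - D, b]` and `[a, b]` gives `DartboardSketch.fisher_le_entropy`,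
with loss of order `D / d + exp (-D / 4)`. The choice `D = 4 * d ^ (3 / 4)` fits this into
`lossFactor`. The denominator is at least 1 when `lossFactor` is nonnegative, so it only weakens the
bound. -/

open scoped BigOperators
open MeasureTheory Set Filter Topology

/-! ### Entropy and Fisher profiles of a single cell, and their ratio -/

/-- The integrand of `H₀ * log 2`. -/
noncomputable def entropyDensity (w : ℝ) : ℝ := hNat (Real.exp (-Real.exp w))

/-- The integrand of `I₀`. -/
noncomputable def fisherDensity (w : ℝ) : ℝ := Real.exp w ^ 2 / (Real.exp (Real.exp w) - 1)

/-- Convexity of `exp`: the point `-x` is a convex combination of `-y` and `0`. -/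
lemma one_sub_exp_neg_div_antitone {x y : ℝ} (hx : 0 < x) (hxy : x ≤ y) :
    (1 - Real.exp (-y)) / y ≤ (1 - Real.exp (-x)) / x := by
  have hy : 0 < y := hx.trans_le hxy
  have h := convexOn_exp.2 (mem_univ (-y)) (mem_univ (0 : ℝ))
    (show 0 ≤ x / y by positivity)
    (show 0 ≤ 1 - x / y by rw [sub_nonneg, div_le_one hy]; exact hxy) (by ring)
  have e : x / y * -y = -x := by field_simp
  simp only [smul_eq_mul, e, mul_zero, add_zero, Real.exp_zero, mul_one] at h
  rw [div_le_div_iff₀ hy hx]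
  have := mul_le_mul_of_nonneg_right h hy.le
  have e2 : (x / y * Real.exp (-y) + (1 - x / y)) * y = x * Real.exp (-y) + (y - x) := by
    field_simp
  rw [e2] at this
  nlinarith

/-- Concavity of `log`: the point `1 - p` is a convex combination of `1 - q` and `1`. -/
lemma neg_log_one_sub_div_monotone {p q : ℝ} (hp : 0 < p) (hpq : p ≤ q) (hq : q < 1) :
    -Real.log (1 - p) / p ≤ -Real.log (1 - q) / q := by
  have hq0 : 0 < q := hp.trans_le hpq
  have h := strictConcaveOn_log_Ioi.concaveOn.2 
    (show 1 - q ∈ Ioi (0 : ℝ) by simpa using hq) (show (1 : ℝ) ∈ Ioi (0 : ℝ) by simp)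
    (show 0 ≤ p / q by positivity)
    (show 0 ≤ 1 - p / q by rw [sub_nonneg, div_le_one hq0]; exact hpq) (by ring)
  have e : p / q * (1 - q) + (1 - p / q) = 1 - p := by field_simp; ring
  simp only [smul_eq_mul, mul_one, e, Real.log_one, mul_zero, add_zero] at h
  rw [div_le_div_iff₀ hp hq0]
  have := mul_le_mul_of_nonneg_right h hq0.le
  have e2 : p / q * Real.log (1 - q) * q = p * Real.log (1 - q) := by field_simp
  rw [e2] at this
  linarith

/-- The ratio of entropy to Fisher information contributed by a cell at scale `w`. -/
noncomputable def densityRatio (w : ℝ) : ℝ :=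
  (1 - Real.exp (-Real.exp w)) / Real.exp w + ((1 - Real.exp (-Real.exp w)) / Real.exp w) ^ 2 *
    (-Real.log (1 - Real.exp (-Real.exp w)) / Real.exp (-Real.exp w))

lemma exp_neg_exp_lt_one (w : ℝ) : Real.exp (-Real.exp w) < 1 := by
  rw [Real.exp_lt_one_iff]
  linarith [Real.exp_pos w]

lemma exp_exp_sub_one_pos (w : ℝ) : 0 < Real.exp (Real.exp w) - 1 := by
  linarith [Real.add_one_lt_exp (Real.exp_pos w).ne', Real.exp_pos w]

lemma fisherDensity_pos (w : ℝ) : 0 < fisherDensity w :=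
  div_pos (by positivity) (exp_exp_sub_one_pos w)

lemma entropyDensity_eq (w : ℝ) :
    entropyDensity w = Real.exp w * Real.exp (-Real.exp w) +
      (1 - Real.exp (-Real.exp w)) * -Real.log (1 - Real.exp (-Real.exp w)) := by
  simp only [entropyDensity, hNat, Real.log_exp]
  ring

lemma entropyDensity_eq_mul_densityRatio (w : ℝ) :
    entropyDensity w = fisherDensity w * densityRatio w := by
  rw [entropyDensity_eq, fisherDensity, densityRatio]
  have h1 := exp_exp_sub_one_pos w
  have hy := Real.exp_pos w
  have hq := Real.exp_pos (-Real.exp w)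
  have e : Real.exp (Real.exp w) - 1 =
      (1 - Real.exp (-Real.exp w)) / Real.exp (-Real.exp w) := by
    rw [eq_div_iff hq.ne', sub_mul, ← Real.exp_add]
    simp
  rw [e] at h1 ⊢
  have hq1 : 1 - Real.exp (-Real.exp w) ≠ 0 := by linarith [exp_neg_exp_lt_one w]
  generalize Real.log (1 - Real.exp (-Real.exp w)) = L
  field_simp

/-- The ratio is built by sums and products from nonnegative decreasing factors; the logarithmic one
increases in `exp (-exp w)`, which decreases in `w`. -/
lemma densityRatio_antitone : Antitone densityRatio := by
  intro v w hvw
  have hy := Real.exp_pos v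
  have hvw' := Real.exp_le_exp.2 hvw
  have h1 := one_sub_exp_neg_div_antitone hy hvw'
  have h2 := neg_log_one_sub_div_monotone (Real.exp_pos (-Real.exp w))
    (Real.exp_le_exp.2 (neg_le_neg hvw')) (exp_neg_exp_lt_one v)
  have h3 : 0 ≤ (1 - Real.exp (-Real.exp w)) / Real.exp w :=
    div_nonneg (by linarith [exp_neg_exp_lt_one w]) (Real.exp_pos _).le
  have h4 : 0 ≤ -Real.log (1 - Real.exp (-Real.exp w)) / Real.exp (-Real.exp w) :=
    div_nonneg (neg_nonneg.2 (Real.log_nonpos (by linarith [exp_neg_exp_lt_one w])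
      (by linarith [Real.exp_pos (-Real.exp w)]))) (Real.exp_pos _).le
  unfold densityRatio
  gcongr

/-! ### Bounds on the profiles and their integrals -/

lemma exp_mul_exp_neg_exp_le_entropyDensity (w : ℝ) :
    Real.exp w * Real.exp (-Real.exp w) ≤ entropyDensity w := by
  rw [entropyDensity_eq]
  have : 0 ≤ (1 - Real.exp (-Real.exp w)) * -Real.log (1 - Real.exp (-Real.exp w)) :=
    mul_nonneg (by linarith [exp_neg_exp_lt_one w])
      (neg_nonneg.2 (Real.log_nonpos (by linarith [exp_neg_exp_lt_one w])
      (by linarith [Real.exp_pos (-Real.exp w)])))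
  linarith

lemma entropyDensity_pos (w : ℝ) : 0 < entropyDensity w :=
  lt_of_lt_of_le (by positivity) (exp_mul_exp_neg_exp_le_entropyDensity w)

lemma sq_exp_mul_exp_neg_exp_le_fisherDensity (w : ℝ) :
    Real.exp w ^ 2 * Real.exp (-Real.exp w) ≤ fisherDensity w := by
  rw [fisherDensity, Real.exp_neg, ← div_eq_mul_inv]
  gcongr
  · exact exp_exp_sub_one_pos w
  · linarith

lemma fisherDensity_le (w : ℝ) : fisherDensity w ≤ 6 * Real.exp (-|w| / 2) := by
  have h1 := exp_exp_sub_one_pos w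
  have hy := Real.exp_pos w
  rcases le_total 0 w with hw | hw
  · have h3 : Real.exp w ^ 3 / 6 ≤ Real.exp (Real.exp w) - 1 := by
      have := Real.sum_le_exp_of_nonneg hy.le 4
      simp [Finset.sum_range_succ, Nat.factorial] at this
      nlinarith
    calc fisherDensity w ≤ 6 * Real.exp (-w) := by
          rw [fisherDensity, div_le_iff₀ h1, Real.exp_neg]
          have : 6 * (Real.exp w)⁻¹ * (Real.exp w ^ 3 / 6) ≤
            6 * (Real.exp w)⁻¹ * (Real.exp (Real.exp w) - 1) := by gcongr
          refine le_trans (le_of_eq ?_) this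
          field_simp
      _ ≤ _ := by
        rw [abs_of_nonneg hw]
        gcongr
        linarith
  · calc fisherDensity w ≤ Real.exp w := by
          rw [fisherDensity, div_le_iff₀ h1]
          nlinarith [Real.add_one_le_exp (Real.exp w)]
      _ ≤ Real.exp (-|w| / 2) := by
          rw [abs_of_nonpos hw, Real.exp_le_exp]
          linarith
      _ ≤ _ := by linarith [Real.exp_pos (-|w| / 2)]

/-- As `w → -∞` the profile behaves like `-w * exp w`. Giving up half of the exponent absorbs the
factor `-w`, through `-log x ≤ 2 / √x`. -/
lemma entropyDensity_le (w : ℝ) : entropyDensity w ≤ 3 * Real.exp (-|w| / 2) := by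
  rw [entropyDensity_eq]
  have hy := Real.exp_pos w
  have hq := Real.exp_pos (-Real.exp w)
  have hq1 := exp_neg_exp_lt_one w
  set x := 1 - Real.exp (-Real.exp w) with hx
  have hx0 : 0 < x := by linarith
  rcases le_total 0 w with hw | hw
  · have h2 : Real.exp w ^ 2 / 2 ≤ Real.exp (Real.exp w) := by
      have := Real.quadratic_le_exp_of_nonneg hy.le
      nlinarith
    have hqle : Real.exp (-Real.exp w) ≤ 2 / Real.exp w ^ 2 := by
      rw [Real.exp_neg, inv_le_comm₀ (Real.exp_pos _) (by positivity)]
      simpa using h2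
    have hlog : x * -Real.log x ≤ Real.exp (-Real.exp w) := by
      have := Real.one_sub_inv_le_log_of_pos hx0
      have h5 : x * (1 - x⁻¹) ≤ x * Real.log x := by gcongr
      rw [mul_sub, mul_inv_cancel₀ hx0.ne'] at h5
      linarith
    have hy1 : 1 ≤ Real.exp w := Real.one_le_exp hw
    have hq' : Real.exp w * Real.exp (-Real.exp w) ≤ Real.exp (-w) := by
      rw [Real.exp_neg w, Real.exp_neg (Real.exp w), ← div_eq_mul_inv, ← one_div, div_le_div_iff₀
        (Real.exp_pos _) hy]
      have := Real.sum_le_exp_of_nonneg hy.le 4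
      simp [Finset.sum_range_succ, Nat.factorial] at this
      nlinarith [sq_nonneg (Real.exp w - 1), sq_nonneg (Real.exp w - 2),
        mul_nonneg hy.le (sq_nonneg (Real.exp w - 2))]
    have e : Real.exp (-w) ≤ Real.exp (-|w| / 2) := by
      rw [abs_of_nonneg hw, Real.exp_le_exp]; linarith
    nlinarith
  · have hlog : x * -Real.log x ≤ 2 * Real.exp (w / 2) := by
      have hs := Real.sqrt_pos.2 hx0
      have h5 : -Real.log x ≤ 2 * (Real.sqrt x)⁻¹ := by
        have := Real.log_le_sub_one_of_pos (inv_pos.2 hs)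
        rw [Real.log_inv, Real.log_sqrt hx0.le] at this
        linarith
      have h6 : x ≤ Real.exp w := by
        linarith [Real.add_one_le_exp (-Real.exp w)]
      calc x * -Real.log x ≤ x * (2 * (Real.sqrt x)⁻¹) := by gcongr
        _ = 2 * Real.sqrt x := by
            nth_rewrite 1 [← Real.mul_self_sqrt hx0.le]
            field_simp
        _ ≤ 2 * Real.sqrt (Real.exp w) := by gcongr
        _ = _ := by rw [Real.exp_half]
    have h7 : Real.exp w * Real.exp (-Real.exp w) ≤ Real.exp (w / 2) := by
      calc _ ≤ Real.exp w * 1 := by gcongr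
        _ ≤ _ := by rw [mul_one, Real.exp_le_exp]; linarith
    rw [abs_of_nonpos hw, neg_neg]
    linarith

lemma continuous_fisherDensity : Continuous fisherDensity := by
  unfold fisherDensity
  exact Continuous.div (by fun_prop) (by fun_prop) fun w => (exp_exp_sub_one_pos w).ne'

lemma continuous_entropyDensity : Continuous entropyDensity := by
  have : entropyDensity = fun w => Real.exp w * Real.exp (-Real.exp w) +
      (1 - Real.exp (-Real.exp w)) * -Real.log (1 - Real.exp (-Real.exp w)) :=
    funext entropyDensity_eq
  rw [this]
  have h : Continuous fun w => Real.log (1 - Real.exp (-Real.exp w)) :=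
    Continuous.log (by fun_prop) fun w => by linarith [exp_neg_exp_lt_one w]
  fun_prop

lemma integrable_exp_neg_abs_div_two : Integrable fun w : ℝ => Real.exp (-|w| / 2) := by
  rw [← integrableOn_univ, ← Iic_union_Ioi (a := (0 : ℝ))]
  refine IntegrableOn.union ?_ ?_
  · refine (integrableOn_exp_mul_Iic (show (0 : ℝ) < 1 / 2 by norm_num) 0).congr_fun ?_
      measurableSet_Iic
    intro w hw
    simp only [abs_of_nonpos (show w ≤ 0 from hw)]
    congr 1
    ring
  · refine (integrableOn_exp_mul_Ioi (show (-1 / 2 : ℝ) < 0 by norm_num) 0).congr_fun ?_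
      measurableSet_Ioi
    intro w hw
    simp only [abs_of_pos (show 0 < w from hw)]
    congr 1
    ring

lemma integral_exp_neg_abs_div_two : ∫ w : ℝ, Real.exp (-|w| / 2) = 4 := by
  rw [integral_comp_abs (f := fun w => Real.exp (-w / 2))]
  have := integral_exp_mul_Ioi (show (-1 / 2 : ℝ) < 0 by norm_num) 0
  have e : (fun w : ℝ => Real.exp (-w / 2)) = fun w => Real.exp (-1 / 2 * w) := by
    ext w
    congr 1
    ring
  rw [e, this]
  norm_num

lemma integrable_entropyDensity : Integrable entropyDensity :=
  (integrable_exp_neg_abs_div_two.const_mul 3).mono'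
    continuous_entropyDensity.aestronglyMeasurable
    (.of_forall fun w => by
      rw [Real.norm_of_nonneg (entropyDensity_pos w).le]
      exact entropyDensity_le w)

lemma integrable_fisherDensity : Integrable fisherDensity :=
  (integrable_exp_neg_abs_div_two.const_mul 6).mono'
    continuous_fisherDensity.aestronglyMeasurable
    (.of_forall fun w => by
      rw [Real.norm_of_nonneg (fisherDensity_pos w).le]
      exact fisherDensity_le w)

lemma integral_entropyDensity_le : ∫ w, entropyDensity w ≤ 12 := by
  calc ∫ w, entropyDensity w ≤ ∫ w : ℝ, 3 * Real.exp (-|w| / 2) :=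
        integral_mono integrable_entropyDensity (integrable_exp_neg_abs_div_two.const_mul 3)
          entropyDensity_le
    _ = 12 := by rw [integral_const_mul, integral_exp_neg_abs_div_two]; norm_num

/-- Serves both profiles: their lower bounds have explicit antiderivatives rising from `-1` to `0`.
-/
lemma one_le_integral_of_hasDerivAt_le {F f g : ℝ → ℝ} (hF : ∀ w, HasDerivAt F (f w) w)
    (hf : Continuous f) (hf0 : ∀ w, 0 ≤ f w) (hfg : ∀ w, f w ≤ g w) (hg : Integrable g)
    (hbot : Tendsto F atBot (𝓝 (-1))) (htop : Tendsto F atTop (𝓝 0)) : 1 ≤ ∫ w, g w := by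
  have hfi : Integrable f := hg.mono' hf.aestronglyMeasurable
    (.of_forall fun w => by rw [Real.norm_of_nonneg (hf0 w)]; exact hfg w)
  have h := integral_of_hasDerivAt_of_tendsto hF hfi hbot htop
  have := integral_mono hfi hg hfg
  linarith

lemma one_le_integral_entropyDensity : 1 ≤ ∫ w, entropyDensity w := by
  refine one_le_integral_of_hasDerivAt_le (F := fun w => -Real.exp (-Real.exp w))
    (f := fun w => Real.exp w * Real.exp (-Real.exp w)) (fun w => ?_) (by fun_prop)
    (fun w => by positivity) exp_mul_exp_neg_exp_le_entropyDensity integrable_entropyDensity ?_ ?_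
  · exact (Real.hasDerivAt_exp w).neg.exp.neg.congr_deriv (by
      simp only [Pi.neg_apply]
      ring)
  · have h : Continuous fun x : ℝ => -Real.exp (-x) := by fun_prop
    refine ((h.tendsto 0).comp Real.tendsto_exp_atBot).trans (le_of_eq ?_)
    norm_num
  · have h : Tendsto (fun x : ℝ => -Real.exp (-x)) atTop (𝓝 (-0)) :=
      (Real.tendsto_exp_neg_atTop_nhds_zero).neg
    refine (h.comp Real.tendsto_exp_atTop).trans (le_of_eq ?_)
    norm_num

lemma one_le_integral_fisherDensity : 1 ≤ ∫ w, fisherDensity w := by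
  refine one_le_integral_of_hasDerivAt_le
    (F := fun w => -(Real.exp w * Real.exp (-Real.exp w) + Real.exp (-Real.exp w)))
    (f := fun w => Real.exp w ^ 2 * Real.exp (-Real.exp w)) (fun w => ?_) (by fun_prop)
    (fun w => by positivity) sq_exp_mul_exp_neg_exp_le_fisherDensity integrable_fisherDensity ?_ ?_
  · have h := (Real.hasDerivAt_exp w).neg.exp
    exact (((Real.hasDerivAt_exp w).mul h).add h).neg.congr_deriv (by
      simp only [Pi.neg_apply]
      ring)
  · have h : Continuous fun x : ℝ => -(x * Real.exp (-x) + Real.exp (-x)) := by fun_prop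
    refine ((h.tendsto 0).comp Real.tendsto_exp_atBot).trans (le_of_eq ?_)
    norm_num
  · have h : Tendsto (fun x : ℝ => -(x * Real.exp (-x) + Real.exp (-x))) atTop (𝓝 (-(0 + 0))) := by
      have := Real.tendsto_pow_mul_exp_neg_atTop_nhds_zero 1
      simp only [pow_one] at this
      exact (this.add Real.tendsto_exp_neg_atTop_nhds_zero).neg
    refine (h.comp Real.tendsto_exp_atTop).trans (le_of_eq ?_)
    norm_num

/-! ### Comparison of tails -/

/-- With `y = exp (u - 1)`, the left side decays like `exp (-e * y)` and the right side only like
`exp (-y)`, which absorbs any polynomial factor. The constant 12 bounds the ratio of the two total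
integrals. -/
lemma fisherDensity_le_entropyDensity_sub_one {u : ℝ} (hu : 1024 ≤ u) :
    12 * fisherDensity u ≤ entropyDensity (u - 1) := by
  refine le_trans ?_ (exp_mul_exp_neg_exp_le_entropyDensity (u - 1))
  set y := Real.exp (u - 1) with hy
  have e : Real.exp u = Real.exp 1 * y := by rw [hy, ← Real.exp_add]; congr 1; ring
  have hyl : 500000 ≤ y := by
    have := Real.quadratic_le_exp_of_nonneg (show 0 ≤ u - 1 by linarith)
    nlinarith
  have h1 : Real.exp 1 < 3 := by linarith [Real.exp_one_lt_d9]
  have h2 : 2 < Real.exp 1 := by linarith [Real.exp_one_gt_d9]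
  have hd := exp_exp_sub_one_pos u
  rw [fisherDensity, ← mul_div_assoc, div_le_iff₀ hd, e]
  have h3 : Real.exp y * Real.exp y ≤ Real.exp (Real.exp 1 * y) := by
    rw [← Real.exp_add, Real.exp_le_exp]
    nlinarith
  have h4 : 1 ≤ Real.exp (-y) * Real.exp (Real.exp 1 * y) / Real.exp y := by
    rw [le_div_iff₀ (Real.exp_pos _), Real.exp_neg, one_mul, ← div_eq_inv_mul,
      le_div_iff₀ (Real.exp_pos _)]
    exact h3
  rw [le_div_iff₀ (Real.exp_pos _)] at h4
  have h5 : y ^ 2 / 2 ≤ Real.exp y - 1 := by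
    nlinarith [Real.quadratic_le_exp_of_nonneg (show 0 ≤ y by linarith)]
  have h6 : Real.exp (-y) ≤ 1 := by rw [Real.exp_le_one_iff]; linarith
  calc 12 * (Real.exp 1 * y) ^ 2 ≤ 12 * (3 * y) ^ 2 := by gcongr
    _ ≤ y * (y ^ 2 / 2) := by nlinarith [sq_nonneg y]
    _ ≤ y * (Real.exp y - 1) := by gcongr
    _ ≤ y * (Real.exp (-y) * Real.exp (Real.exp 1 * y) - Real.exp (-y)) := by
        gcongr
        · linarith
    _ = _ := by ring

/-- The entropy of cells at scales above `A - D` controls the Fisher information at scales above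
`A`, uniformly in `A`. -/
lemma integral_fisherDensity_Ioi_le {D : ℝ} (hD : 2048 ≤ D) (A : ℝ) :
    (1 - 6 * Real.exp (-D / 4)) * ((∫ w, entropyDensity w) / ∫ w, fisherDensity w) *
      ∫ w in Ioi A, fisherDensity w ≤ ∫ w in Ioi (A - D), entropyDensity w := by
  set E := ∫ w, entropyDensity w with hE
  set G := ∫ w, fisherDensity w with hG
  have hE1 : 1 ≤ E := one_le_integral_entropyDensity
  have hG1 : 1 ≤ G := one_le_integral_fisherDensity
  have hE12 : E ≤ 12 := integral_entropyDensity_le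
  have hei := integrable_entropyDensity
  have hfi := integrable_fisherDensity
  have hJ0 : 0 ≤ ∫ w in Ioi A, fisherDensity w :=
    setIntegral_nonneg measurableSet_Ioi fun w _ => (fisherDensity_pos w).le
  -- For `A ≤ D / 2` the window above `A - D` contains `(-D / 2, ∞)`, hence all the entropy mass up
  -- to `6 * exp (-D / 4)`. For larger `A` both tails are tiny, but a shift by 1 already suffices.
  rcases le_total A (D / 2) with hA | hA
  · have hJ : ∫ w in Ioi A, fisherDensity w ≤ G :=
      setIntegral_le_integral hfi (.of_forall fun w => (fisherDensity_pos w).le)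
    have hT : ∫ w in Iic (-D / 2), entropyDensity w ≤ 6 * Real.exp (-D / 4) := by
      calc ∫ w in Iic (-D / 2), entropyDensity w
          ≤ ∫ w in Iic (-D / 2), 3 * Real.exp (1 / 2 * w) := by
            refine setIntegral_mono_on hei.integrableOn
              ((integrableOn_exp_mul_Iic (by norm_num) _).const_mul 3) measurableSet_Iic ?_
            intro w hw
            have hw' : w ≤ -D / 2 := hw
            have := entropyDensity_le w
            rw [abs_of_nonpos (by linarith)] at this
            rwa [neg_neg, show w / 2 = 1 / 2 * w by ring] at this
        _ = _ := by
            rw [integral_const_mul, integral_exp_mul_Iic (by norm_num)]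
            rw [show (1 / 2 * (-D / 2) : ℝ) = -D / 4 by ring]
            ring
    have hsplit := integral_add_compl (measurableSet_Iic (a := -D / 2)) hei
    rw [compl_Iic] at hsplit
    have hmono : ∫ w in Ioi (-D / 2), entropyDensity w ≤ ∫ w in Ioi (A - D), entropyDensity w :=
      setIntegral_mono_set hei.integrableOn (.of_forall fun w => (entropyDensity_pos w).le)
        (Ioi_subset_Ioi (by linarith)).eventuallyLE
    rcases le_total 0 (1 - 6 * Real.exp (-D / 4)) with h0 | h0
    · calc _ ≤ (1 - 6 * Real.exp (-D / 4)) * (E / G) * G := by gcongr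
        _ = (1 - 6 * Real.exp (-D / 4)) * E := by field_simp
        -- The absolute error becomes a relative one because `1 ≤ E`.
        _ ≤ E - 6 * Real.exp (-D / 4) := by nlinarith [Real.exp_pos (-D / 4)]
        _ ≤ _ := by linarith
    · calc _ ≤ 0 := mul_nonpos_of_nonpos_of_nonneg
            (mul_nonpos_of_nonpos_of_nonneg h0 (by positivity)) hJ0
        _ ≤ _ := setIntegral_nonneg measurableSet_Ioi fun w _ => (entropyDensity_pos w).le
  · have hEG : E / G ≤ 12 := by
      rw [div_le_iff₀ (by linarith)]
      linarith
    have hEG0 : 0 ≤ E / G := by positivity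
    calc _ ≤ 12 * ∫ w in Ioi A, fisherDensity w := by
          gcongr
          nlinarith [Real.exp_pos (-D / 4)]
      _ = ∫ w in Ioi A, 12 * fisherDensity w := (integral_const_mul _ _).symm
      _ ≤ ∫ w in Ioi A, entropyDensity (w - 1) :=
          setIntegral_mono_on (hfi.const_mul 12).integrableOn
            (hei.comp_sub_right 1).integrableOn measurableSet_Ioi fun w hw =>
              fisherDensity_le_entropyDensity_sub_one (by linarith [show A < w from hw])
      _ = ∫ w in Ioi (A - 1), entropyDensity w := by
          have := integral_sub_right_eq_self (μ := (volume : Measure ℝ))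
            (fun w => (Ioi (A - 1)).indicator entropyDensity w) (1 : ℝ)
          rw [integral_indicator measurableSet_Ioi] at this
          rw [← this, ← integral_indicator measurableSet_Ioi]
          congr 1
          ext w
          simp [indicator, mem_Ioi]
      _ ≤ _ := setIntegral_mono_set hei.integrableOn
          (.of_forall fun w => (entropyDensity_pos w).le)
          (Ioi_subset_Ioi (by linarith)).eventuallyLE

/-! ### Comparison under a decreasing weight -/

/-- If `f - c * g` changes sign at most once, from nonnegative to negative, on `[a, b]`, then a
decreasing weight preserves the comparison of the integrals of `f` and `c * g`. -/
lemma integral_antitone_mul_le {k f g : ℝ → ℝ} {c a a' b : ℝ} (ha : a' ≤ a) (hab : a ≤ b)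
    (hk : Antitone k) (hk0 : ∀ x, 0 ≤ k x) (hkc : Continuous k) (hf : Continuous f)
    (hg : Continuous g) (hf0 : ∀ x, 0 ≤ f x)
    (hsign : ∃ τ ∈ Icc a b, (∀ x ∈ Ico a τ, c * g x ≤ f x) ∧ ∀ x ∈ Ioc τ b, f x ≤ c * g x)
    (hint : c * ∫ x in a..b, g x ≤ ∫ x in a'..b, f x) :
    c * ∫ x in a..b, k x * g x ≤ ∫ x in a'..b, k x * f x := by
  -- Replacing `k` by the constant `k τ` only lowers the integral of `k * (f - c * g)`: before `τ`
  -- the weight is larger and the difference nonnegative, after `τ` both are reversed. On `[a', a]`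
  -- only `f ≥ 0` is needed.
  obtain ⟨τ, hτ, h1, h2⟩ := hsign
  have ii : ∀ {u : ℝ → ℝ} (_ : Continuous u) (x y : ℝ), IntervalIntegrable u volume x y :=
    fun hu x y => hu.intervalIntegrable x y
  have e1 : k τ * ∫ x in a'..a, f x ≤ ∫ x in a'..a, k x * f x := by
    rw [← intervalIntegral.integral_const_mul]
    refine intervalIntegral.integral_mono_on ha (ii (by fun_prop) _ _) (ii (by fun_prop) _ _) ?_
    intro x hx
    exact mul_le_mul_of_nonneg_right (hk (hx.2.trans hτ.1)) (hf0 x)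
  have e2 : k τ * ∫ x in a..b, (f x - c * g x) ≤ ∫ x in a..b, k x * (f x - c * g x) := by
    rw [← intervalIntegral.integral_const_mul]
    refine intervalIntegral.integral_mono_on hab (ii (by fun_prop) _ _) (ii (by fun_prop) _ _) ?_
    intro x hx
    rcases lt_trichotomy x τ with h | h | h
    · exact mul_le_mul_of_nonneg_right (hk h.le) (sub_nonneg.2 (h1 x ⟨hx.1, h⟩))
    · rw [h]
    · exact mul_le_mul_of_nonpos_right (hk h.le) (sub_nonpos.2 (h2 x ⟨h, hx.2⟩))
  have e3 : ∫ x in a..b, (f x - c * g x) = (∫ x in a..b, f x) - c * ∫ x in a..b, g x := by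
    rw [intervalIntegral.integral_sub (ii (by fun_prop) _ _) (ii (by fun_prop) _ _),
      intervalIntegral.integral_const_mul]
  have e4 : ∫ x in a..b, k x * (f x - c * g x) =
      (∫ x in a..b, k x * f x) - c * ∫ x in a..b, k x * g x := by
    rw [← intervalIntegral.integral_const_mul, ← intervalIntegral.integral_sub
      (ii (by fun_prop) _ _) (ii (by fun_prop) _ _)]
    congr 1
    ext x
    ring
  have e5 := intervalIntegral.integral_add_adjacent_intervals (ii hf a' a) (ii hf a b)
  have e6 := intervalIntegral.integral_add_adjacent_intervals
    (ii (hkc.mul hf) a' a) (ii (hkc.mul hf) a b)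
  simp only [Pi.mul_apply] at e6
  have := mul_le_mul_of_nonneg_left hint (hk0 τ)
  rw [e3] at e2
  rw [e4] at e2
  rw [← e5] at this
  nlinarith

lemma entropyDensity_le_of_le {c v w : ℝ} (hvw : v ≤ w)
    (h : entropyDensity v ≤ c * fisherDensity v) : entropyDensity w ≤ c * fisherDensity w := by
  rw [entropyDensity_eq_mul_densityRatio, mul_comm,
    mul_le_mul_iff_left₀ (fisherDensity_pos _)] at h ⊢
  exact (densityRatio_antitone hvw).trans h

lemma le_entropyDensity_of_le {c v w : ℝ} (hvw : v ≤ w)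
    (h : c * fisherDensity w ≤ entropyDensity w) : c * fisherDensity v ≤ entropyDensity v := by
  rw [entropyDensity_eq_mul_densityRatio, mul_comm,
    mul_le_mul_iff_right₀ (fisherDensity_pos _)] at h ⊢
  exact h.trans (densityRatio_antitone hvw)

/-- Scale by scale comparison of Fisher information and entropy under a decreasing weight. -/
lemma integral_weighted_fisherDensity_le {k : ℝ → ℝ} (hk : Antitone k) (hk0 : ∀ x, 0 ≤ k x)
    (hkc : Continuous k) {a b D : ℝ} (hab : a ≤ b) (hD : 2048 ≤ D)
    (hD' : 6 * Real.exp (-D / 4) ≤ 1) (w : ℝ) :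
    (1 - 6 * Real.exp (-D / 4)) * ((∫ w, entropyDensity w) / ∫ w, fisherDensity w) *
      ∫ x in a..b, k x * fisherDensity (x + w) ≤
    ∫ x in (a - D)..b, k x * entropyDensity (x + w) := by
  set c := (1 - 6 * Real.exp (-D / 4)) * ((∫ w, entropyDensity w) / ∫ w, fisherDensity w) with hc
  have hec := continuous_entropyDensity
  have hfc := continuous_fisherDensity
  have hc0 : 0 ≤ c := by
    have := one_le_integral_entropyDensity
    have := one_le_integral_fisherDensity
    have : 0 ≤ 1 - 6 * Real.exp (-D / 4) := by linarith
    positivity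
  have hmain := integral_fisherDensity_Ioi_le hD (a + w)
  rw [← hc] at hmain
  have hei := integrable_entropyDensity
  have hfi := integrable_fisherDensity
  -- The sign at the right end decides how to truncate the infinite tails at `b`. If entropy still
  -- dominates at `b`, it dominates pointwise on all of `[a, b]`.
  by_cases hb : c * fisherDensity (b + w) ≤ entropyDensity (b + w)
  · have hle : ∀ x ≤ b, c * fisherDensity (x + w) ≤ entropyDensity (x + w) := fun x hx =>
      le_entropyDensity_of_le (by linarith) hb
    have hI : c * ∫ x in a..b, fisherDensity (x + w) ≤ ∫ x in (a - D)..b, entropyDensity (x + w) := by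
      have e5 := intervalIntegral.integral_add_adjacent_intervals (a := a - D) (b := a) (c := b)
        (μ := volume) (f := fun x => entropyDensity (x + w))
        (Continuous.intervalIntegrable (by fun_prop) _ _)
        (Continuous.intervalIntegrable (by fun_prop) _ _)
      have e6 : 0 ≤ ∫ x in (a - D)..a, entropyDensity (x + w) :=
        intervalIntegral.integral_nonneg (by linarith) fun x _ => (entropyDensity_pos _).le
      rw [← e5, ← intervalIntegral.integral_const_mul]
      have : ∫ x in a..b, c * fisherDensity (x + w) ≤ ∫ x in a..b, entropyDensity (x + w) :=
        intervalIntegral.integral_mono_on hab (Continuous.intervalIntegrable (by fun_prop) _ _)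
          (Continuous.intervalIntegrable (by fun_prop) _ _) fun x hx => hle x hx.2
      linarith
    exact integral_antitone_mul_le (by linarith) hab hk hk0 hkc (by fun_prop) (by fun_prop)
      (fun x => (entropyDensity_pos _).le)
      ⟨b, ⟨hab, le_rfl⟩, fun x hx => hle x hx.2.le, fun x hx => absurd hx.1 (not_lt.2 hx.2)⟩ hI
  · push Not at hb
    -- Otherwise `c * fisherDensity` dominates beyond `b`, so removing that tail from both sides of
    -- `hmain` preserves the inequality.
    have hge : ∀ v ∈ Ioi (b + w), entropyDensity v ≤ c * fisherDensity v := fun v hv =>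
      entropyDensity_le_of_le (le_of_lt hv) hb.le
    have hI : c * ∫ x in a..b, fisherDensity (x + w) ≤
        ∫ x in (a - D)..b, entropyDensity (x + w) := by
      rw [intervalIntegral.integral_comp_add_right, intervalIntegral.integral_comp_add_right]
      have h1 := intervalIntegral.integral_interval_add_Ioi (a := a + w) (b := b + w)
        hfi.integrableOn hfi.integrableOn
      have h2 := intervalIntegral.integral_interval_add_Ioi (a := a - D + w) (b := b + w)
        hei.integrableOn hei.integrableOn
      have h3 : ∫ v in Ioi (b + w), entropyDensity v ≤ ∫ v in Ioi (b + w), c * fisherDensity v :=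
        setIntegral_mono_on hei.integrableOn (hfi.const_mul c).integrableOn measurableSet_Ioi hge
      rw [integral_const_mul] at h3
      rw [show a + w - D = a - D + w by ring, ← h1, ← h2] at hmain
      linarith
    refine integral_antitone_mul_le (by linarith) hab hk hk0 hkc (by fun_prop) (by fun_prop)
      (fun x => (entropyDensity_pos _).le) ?_ hI
    by_cases ha : entropyDensity (a + w) ≤ c * fisherDensity (a + w)
    · exact ⟨a, ⟨le_rfl, hab⟩, fun x hx => absurd hx.2 (not_lt.2 hx.1), fun x hx =>
        entropyDensity_le_of_le (by linarith [hx.1]) ha⟩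
    · push Not at ha
      obtain ⟨τ, hτ, h0⟩ := intermediate_value_Icc' hab
        (f := fun x => entropyDensity (x + w) - c * fisherDensity (x + w)) (by fun_prop)
        (show (0 : ℝ) ∈ Icc _ _ from ⟨by linarith, by linarith⟩)
      simp only [sub_eq_zero] at h0
      exact ⟨τ, hτ, fun x hx => le_entropyDensity_of_le (add_le_add_left hx.2.le w) h0.ge,
        fun x hx => entropyDensity_le_of_le (add_le_add_left hx.1.le w) h0.le⟩

/-! ### Words generated from left to right: chain rules and monotonicity -/

/-- The conditional mass function of the bit `Y i = Z i ∨ b`, where `Z i` vanishes with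
probability `q`. -/
noncomputable def bitProb (q : ℝ) (b y : Bool) : ℝ :=
  if b then (if y then 1 else 0) else (if y then 1 - q else q)

/-- The probability of the word `y` when bits are generated from left to right, the `i`-th being
`Z i ∨ φ i (y 0, …, y (i-1))` for independent `Z i` with `P (Z i = 0) = q i`. -/
noncomputable def wordProb (φ : (i : ℕ) → (Fin i → Bool) → Bool) (q : ℕ → ℝ) :
    (n : ℕ) → (Fin n → Bool) → ℝ
  | 0, _ => 1
  | n + 1, y => wordProb φ q n (Fin.init y) * bitProb (q n) (φ n (Fin.init y)) (y (Fin.last n))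

/-- The probability that the `n`-th bit is not forced by the preceding ones. -/
noncomputable def freeProb (φ : (i : ℕ) → (Fin i → Bool) → Bool) (q : ℕ → ℝ) (n : ℕ) : ℝ :=
  ∑ y : Fin n → Bool, wordProb φ q n y * if φ n y then 0 else 1

lemma sum_word_succ {n : ℕ} (F : (Fin (n + 1) → Bool) → ℝ) :
    ∑ y, F y = ∑ w : Fin n → Bool, (F (Fin.snoc w true) + F (Fin.snoc w false)) := by
  rw [← (Fin.snocEquiv fun _ => Bool).sum_comp, Fintype.sum_prod_type_right]
  simp [Fin.snocEquiv]

section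

variable (φ : (i : ℕ) → (Fin i → Bool) → Bool)

lemma wordProb_snoc (q : ℕ → ℝ) (n : ℕ) (w : Fin n → Bool) (b : Bool) :
    wordProb φ q (n + 1) (Fin.snoc w b : Fin (n + 1) → Bool) =
      wordProb φ q n w * bitProb (q n) (φ n w) b := by
  simp [wordProb, Fin.init_snoc (α := fun _ => Bool), Fin.snoc_last (α := fun _ => Bool)]

lemma bitProb_nonneg {q : ℝ} (h0 : 0 ≤ q) (h1 : q ≤ 1) (b y : Bool) : 0 ≤ bitProb q b y := by
  unfold bitProb
  split_ifs <;> linarith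

lemma bitProb_add (q : ℝ) (b : Bool) : bitProb q b true + bitProb q b false = 1 := by
  cases b <;> simp [bitProb]

lemma wordProb_nonneg {q : ℕ → ℝ} (h0 : ∀ i, 0 ≤ q i) (h1 : ∀ i, q i ≤ 1) (n : ℕ)
    (y : Fin n → Bool) : 0 ≤ wordProb φ q n y := by
  induction n with
  | zero => exact zero_le_one
  | succ n ih => exact mul_nonneg (ih _) (bitProb_nonneg (h0 n) (h1 n) _ _)

lemma freeProb_nonneg {q : ℕ → ℝ} (h0 : ∀ i, 0 ≤ q i) (h1 : ∀ i, q i ≤ 1) (n : ℕ) :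
    0 ≤ freeProb φ q n :=
  Finset.sum_nonneg fun y _ => mul_nonneg (wordProb_nonneg φ h0 h1 n y) (by split_ifs <;> norm_num)

lemma sum_wordProb (q : ℕ → ℝ) (n : ℕ) : ∑ y, wordProb φ q n y = 1 := by
  induction n with
  | zero => simp [wordProb]
  | succ n ih =>
    rw [sum_word_succ, ← ih]
    refine Finset.sum_congr rfl fun w _ => ?_
    rw [wordProb_snoc, wordProb_snoc, ← mul_add, bitProb_add, mul_one]

/-- Chain rule for entropy. -/
lemma sum_negMulLog_wordProb (q : ℕ → ℝ) (n : ℕ) :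
    ∑ y, Real.negMulLog (wordProb φ q n y) =
      ∑ i ∈ Finset.range n, freeProb φ q i * hNat (q i) := by
  induction n with
  | zero => simp [wordProb]
  | succ n ih =>
    rw [sum_word_succ, Finset.sum_range_succ, ← ih, freeProb, Finset.sum_mul,
      ← Finset.sum_add_distrib]
    refine Finset.sum_congr rfl fun w _ => ?_
    rw [wordProb_snoc, wordProb_snoc, Real.negMulLog_mul, Real.negMulLog_mul]
    cases φ n w <;> simp [bitProb, hNat, Real.negMulLog]
    ring

/-- Stochastic domination: raising the zero-probabilities makes words smaller. The induction
averages out the last bit, so it needs all antitone `F`, not only the indicator used for `freeProb`.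
-/
lemma sum_wordProb_mul_le_of_antitone (hφ : ∀ i, Monotone (φ i)) {q q' : ℕ → ℝ}
    (h0 : ∀ i, 0 ≤ q i) (hq : ∀ i, q i ≤ q' i) (h1 : ∀ i, q' i ≤ 1) (n : ℕ)
    (F : (Fin n → Bool) → ℝ) (hF : Antitone F) :
    ∑ y, wordProb φ q n y * F y ≤ ∑ y, wordProb φ q' n y * F y := by
  induction n with
  | zero => simp [wordProb]
  | succ n ih =>
    have key : ∀ p : ℕ → ℝ, ∑ y, wordProb φ p (n + 1) y * F y =
        ∑ w, wordProb φ p n w * (bitProb (p n) (φ n w) true * F (Fin.snoc w true) +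
          bitProb (p n) (φ n w) false * F (Fin.snoc w false)) := by
      intro p
      rw [sum_word_succ]
      refine Finset.sum_congr rfl fun w _ => ?_
      rw [wordProb_snoc, wordProb_snoc]
      ring
    have snoc_le : ∀ {v w : Fin n → Bool} {b c : Bool}, v ≤ w → b ≤ c →
        F (Fin.snoc w c) ≤ F (Fin.snoc v b) := by
      intro v w b c hvw hbc
      apply hF
      intro i
      refine Fin.lastCases ?_ (fun j => ?_) i
      · simpa using hbc
      · simpa using hvw j
    rw [key, key]
    refine (ih _ ?_).trans (Finset.sum_le_sum fun w _ => ?_)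
    -- The average over the last bit is again antitone in the prefix: a larger prefix lowers both
    -- values of `F` and, as `φ` is monotone, can only switch the last bit from random to forced
    -- true.
    · intro v w hvw
      have a1 := snoc_le hvw (le_refl true)
      have a2 := snoc_le hvw (le_refl false)
      have a3 := snoc_le (le_refl v) (Bool.false_le true)
      have a4 := snoc_le (le_refl w) (Bool.false_le true)
      have b0 := h0 n
      have b1 : q n ≤ 1 := (hq n).trans (h1 n)
      have hm := hφ n hvw
      cases hv : φ n v <;> cases hw : φ n w <;> simp only [hv, hw] at hm
      · simp [bitProb, hv, hw]
        nlinarith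
      · simp [bitProb, hv, hw]
        nlinarith
      · exact absurd hm (by decide)
      · simpa [bitProb, hv, hw] using a1
    · refine mul_le_mul_of_nonneg_left ?_
        (wordProb_nonneg φ (fun i => (h0 i).trans (hq i)) h1 n w)
      have a3 := snoc_le (le_refl w) (Bool.false_le true)
      cases φ n w
      · simp [bitProb]
        nlinarith [hq n]
      · simp [bitProb]

lemma freeProb_le_of_le (hφ : ∀ i, Monotone (φ i)) {q q' : ℕ → ℝ}
    (h0 : ∀ i, 0 ≤ q i) (hq : ∀ i, q i ≤ q' i) (h1 : ∀ i, q' i ≤ 1) (n : ℕ) :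
    freeProb φ q n ≤ freeProb φ q' n := by
  refine sum_wordProb_mul_le_of_antitone φ hφ h0 hq h1 n _ fun v w hvw => ?_
  have hm := hφ n hvw
  revert hm
  cases φ n v <;> cases φ n w <;> intro hm
  · simp
  · simp
  · exact absurd hm (by decide)
  · simp

/-- The derivative in `t` of `bitProb (exp (-p t)) b y`. -/
noncomputable def bitProbDeriv (p t : ℝ) (b y : Bool) : ℝ :=
  if b then 0 else (if y then p * Real.exp (-p * t) else -(p * Real.exp (-p * t)))

lemma hasDerivAt_bitProb (p t : ℝ) (b y : Bool) :
    HasDerivAt (fun s => bitProb (Real.exp (-p * s)) b y) (bitProbDeriv p t b y) t := by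
  have h : HasDerivAt (fun s => Real.exp (-p * s)) (-(p * Real.exp (-p * t))) t :=
    ((hasDerivAt_id t).const_mul (-p)).exp.congr_deriv (by simp; ring)
  cases b <;> cases y <;> simp only [bitProb, bitProbDeriv]
  · simpa using h
  · simpa using h.const_sub 1
  · simpa using hasDerivAt_const t (0 : ℝ)
  · simpa using hasDerivAt_const t (1 : ℝ)

lemma differentiable_wordProb (p : ℕ → ℝ) (n : ℕ) (y : Fin n → Bool) :
    Differentiable ℝ fun t => wordProb φ (fun i => Real.exp (-p i * t)) n y := by
  induction n with
  | zero => exact differentiable_const _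
  | succ n ih =>
    exact (ih _).mul fun t => (hasDerivAt_bitProb (p n) t _ _).differentiableAt

lemma continuous_freeProb (p : ℕ → ℝ) (n : ℕ) :
    Continuous fun t => freeProb φ (fun i => Real.exp (-p i * t)) n :=
  continuous_finsetSum _ fun y _ => (differentiable_wordProb φ p n y).continuous.mul_const _

/-- Chain rule for Fisher information. -/
lemma fisherInformation_wordProb {p : ℕ → ℝ} {t : ℝ} (ht : 0 < t) (hp : ∀ i, 0 ≤ p i) (n : ℕ) :
    fisherInformation (fun s => wordProb φ (fun i => Real.exp (-p i * s)) n) t =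
      ∑ i ∈ Finset.range n, freeProb φ (fun i => Real.exp (-p i * t)) i *
        (p i ^ 2 / (Real.exp (p i * t) - 1)) := by
  induction n with
  | zero => simp [fisherInformation, wordProb]
  | succ n ih =>
    rw [Finset.sum_range_succ, ← ih, fisherInformation, fisherInformation, sum_word_succ, freeProb,
      Finset.sum_mul, ← Finset.sum_add_distrib]
    refine Finset.sum_congr rfl fun w _ => ?_
    have hd : ∀ b, deriv (fun s => wordProb φ (fun i => Real.exp (-p i * s)) (n + 1)
        (Fin.snoc w b : Fin (n + 1) → Bool)) t =
        deriv (fun s => wordProb φ (fun i => Real.exp (-p i * s)) n w) t *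
          bitProb (Real.exp (-p n * t)) (φ n w) b +
        wordProb φ (fun i => Real.exp (-p i * t)) n w * bitProbDeriv (p n) t (φ n w) b := by
      intro b
      simp only [wordProb_snoc]
      exact (((differentiable_wordProb φ p n w) t).hasDerivAt.mul
        (hasDerivAt_bitProb (p n) t (φ n w) b)).deriv
    rw [hd, hd, wordProb_snoc, wordProb_snoc]
    generalize deriv (fun s => wordProb φ (fun i => Real.exp (-p i * s)) n w) t = f'
    generalize wordProb φ (fun i => Real.exp (-p i * t)) n w = f
    -- Words of probability zero contribute nothing on either side. For the others the cross terms
    -- cancel, since the derivatives of the two bit probabilities sum to zero.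
    rcases eq_or_ne f 0 with rfl | hf
    · simp
    cases φ n w
    -- For `p n = 0` the summand `p ^ 2 / (exp (p * t) - 1)` is `0 / 0 = 0`, which is the correct
    -- value as the bit is deterministic.
    · rcases (hp n).eq_or_lt with h | h
      · simp [bitProb, bitProbDeriv, ← h]
      · have hq := Real.exp_pos (-p n * t)
        have hq1 : Real.exp (-p n * t) < 1 := by
          rw [Real.exp_lt_one_iff]
          nlinarith
        have e : Real.exp (p n * t) = (Real.exp (-p n * t))⁻¹ := by
          rw [← Real.exp_neg]
          congr 1
          ring
        have h1 : 1 - Real.exp (-p n * t) ≠ 0 := by linarith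
        simp only [bitProb, bitProbDeriv, e, Bool.false_eq_true, if_false, if_true]
        generalize Real.exp (-p n * t) = u at hq h1
        have e2 : u⁻¹ - 1 = (1 - u) / u := by field_simp
        rw [e2]
        field_simp
        ring
    · simp [bitProb, bitProbDeriv]

end

/-! ### Law of the Poissonized sketch -/

/-- A function on a finite partial order is determined by its sums over lower sets. -/
lemma eq_of_sum_le_eq {α : Type*} [PartialOrder α] [Fintype α] [DecidableLE α] {f g : α → ℝ}
    (h : ∀ b, ∑ a with a ≤ b, f a = ∑ a with a ≤ b, g a) : f = g := by
  classical
  ext b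
  induction b using WellFoundedLT.induction with
  | ind b ih =>
    have hb := h b
    have e : Finset.univ.filter (· ≤ b) = insert b (Finset.univ.filter (· < b)) := by
      ext a
      simp [le_iff_eq_or_lt]
    rw [e, Finset.sum_insert (by simp), Finset.sum_insert (by simp)] at hb
    have : ∑ a with a < b, f a = ∑ a with a < b, g a :=
      Finset.sum_congr rfl fun a ha => ih a (by simpa using ha)
    linarith

namespace DartboardSketch

variable {C : Type*}

open scoped Classical in
/-- The word recording which of the cells `c i` are hit by the darts `x`. -/
noncomputable def hitWord (S : DartboardSketch C) {n : ℕ} (c : Fin n → C) {k : ℕ}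
    (x : Fin k → Dartboard) : Fin n → Bool :=
  fun i => decide (∃ j, S.cellOf (x j) = c i)

/-- The area of a cell. -/
noncomputable def cellArea (S : DartboardSketch C) (c : C) : ℝ :=
  volume.real (S.cellOf ⁻¹' {c})

lemma measurableSet_preimage [Finite C] (S : DartboardSketch C) (B : Set C) :
    MeasurableSet (S.cellOf ⁻¹' B) := by
  rw [← biUnion_preimage_singleton]
  exact B.toFinite.measurableSet_biUnion fun c _ => S.measurableSet_cell c

lemma measurable_cellOf_apply [Finite C] (S : DartboardSketch C) {k : ℕ} (B : Set C) (j : Fin k) :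
    MeasurableSet {x : Fin k → Dartboard | S.cellOf (x j) ∈ B} :=
  (S.measurableSet_preimage B).preimage (measurable_pi_apply (X := fun _ : Fin k => Dartboard) j)

lemma measurable_hitWord [Finite C] (S : DartboardSketch C) {n : ℕ} (c : Fin n → C) {k : ℕ}
    (z : Fin n → Bool) : MeasurableSet {x : Fin k → Dartboard | S.hitWord c x = z} := by
  classical
  have : {x : Fin k → Dartboard | S.hitWord c x = z} =
      ⋂ i, {x | S.hitWord c x i = z i} := by
    ext x
    simp [funext_iff]
  rw [this]
  refine MeasurableSet.iInter fun i => ?_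
  have h : MeasurableSet {x : Fin k → Dartboard | ∃ j, S.cellOf (x j) = c i} := by
    rw [ofPred_exists]
    exact MeasurableSet.iUnion fun j => S.measurable_cellOf_apply {c i} j
  cases hz : z i
  · convert h.compl using 1
    ext x
    simp [hitWord]
  · convert h using 1
    ext x
    simp [hitWord]

lemma sum_cellArea [Fintype C] (S : DartboardSketch C) (B : Finset C) :
    volume.real (S.cellOf ⁻¹' B) = ∑ c ∈ B, S.cellArea c := by
  have := measureReal_biUnion_finset (μ := volume) (s := B) (f := fun c => S.cellOf ⁻¹' {c})
    (fun a _ b _ hab => (disjoint_singleton.2 hab).preimage _)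
    (fun c _ => S.measurableSet_cell c)
  unfold cellArea
  rw [← this, ← biUnion_preimage_singleton]
  rfl

/-- The event says that every dart avoids the cells where `z` is false, so it is a product set.
Lower sets have this simple form, whereas a single hit word would require inclusion–exclusion. -/
lemma volume_hitWord_le [Fintype C] (S : DartboardSketch C) {n : ℕ} (c : Fin n ≃ C) (k : ℕ)
    (z : Fin n → Bool) :
    volume.real {x : Fin k → Dartboard | S.hitWord c x ≤ z} =
      (1 - ∑ i with z i = false, S.cellArea (c i)) ^ k := by
  classical
  set B : Finset C := Finset.univ.filter fun a => z (c.symm a) = true with hB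
  have e : {x : Fin k → Dartboard | S.hitWord c x ≤ z} = Set.univ.pi fun _ => S.cellOf ⁻¹' B := by
    ext x
    simp only [mem_ofPred_eq, hitWord, Pi.le_def, mem_univ_pi, mem_preimage, hB, Finset.coe_filter,
      Finset.mem_univ, true_and]
    constructor
    · intro h j
      have := h (c.symm (S.cellOf (x j)))
      rw [decide_eq_true (⟨j, by simp⟩ : ∃ j', _)] at this
      exact Bool.eq_true_of_true_le this
    · intro h i
      by_cases hi : ∃ j, S.cellOf (x j) = c i
      · obtain ⟨j, hj⟩ := hi
        have := h j
        rw [hj, Equiv.symm_apply_apply] at this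
        rw [this]
        exact Bool.le_true _
      · rw [decide_eq_false hi]
        exact Bool.false_le _
  have h1 : ∑ a ∈ B, S.cellArea a = 1 - ∑ i with z i = false, S.cellArea (c i) := by
    have h2 : ∑ a, S.cellArea a = 1 := by
      rw [← S.sum_cellArea]
      simp
    have h3 : ∑ i with z i = false, S.cellArea (c i) = ∑ a with ¬ z (c.symm a) = true,
        S.cellArea a := by
      refine Finset.sum_equiv c (by simp) (by simp)
    rw [h3, ← h2, ← Finset.sum_filter_add_sum_filter_not Finset.univ
      (fun a => z (c.symm a) = true)]
    ring
  rw [e, Measure.real, volume_pi_pi, ENNReal.toReal_prod, Finset.prod_const, Finset.card_univ,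
    Fintype.card_fin, ← h1, ← S.sum_cellArea]
  rfl

lemma summable_poisson_mul (t : ℝ) {u : ℕ → ℝ} (h0 : ∀ k, 0 ≤ u k) (h1 : ∀ k, u k ≤ 1) :
    Summable fun k : ℕ => Real.exp (-t) * t ^ k / (k.factorial : ℝ) * u k := by
  refine Summable.of_norm_bounded ((Real.summable_pow_div_factorial |t|).mul_left (Real.exp (-t)))
    fun k => ?_
  rw [norm_mul, Real.norm_of_nonneg (h0 k), mul_div_assoc, norm_mul, norm_div, norm_pow,
    Real.norm_of_nonneg (Real.exp_pos _).le, Real.norm_natCast, Real.norm_eq_abs]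
  exact mul_le_of_le_one_right (by positivity) (h1 k)

lemma sum_tsum_poisson_hitWord [Finite C] (S : DartboardSketch C) {n : ℕ} (c : Fin n → C) (t : ℝ)
    (A : Finset (Fin n → Bool)) :
    ∑ z ∈ A, ∑' k : ℕ, Real.exp (-t) * t ^ k / (k.factorial : ℝ) *
      volume.real {x : Fin k → Dartboard | S.hitWord c x = z} =
    ∑' k : ℕ, Real.exp (-t) * t ^ k / (k.factorial : ℝ) *
      volume.real {x : Fin k → Dartboard | S.hitWord c x ∈ A} := by
  rw [← Summable.tsum_finsetSum fun z _ =>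
    summable_poisson_mul t (fun k => measureReal_nonneg) (fun k => measureReal_le_one)]
  refine tsum_congr fun k => ?_
  rw [← Finset.mul_sum]
  congr 1
  have := measureReal_biUnion_finset (μ := volume) (s := A)
    (f := fun z => {x : Fin k → Dartboard | S.hitWord c x = z})
    (fun a _ b _ hab => (disjoint_singleton.2 hab).preimage (S.hitWord c))
    (fun z _ => S.measurable_hitWord c z)
  rw [← this]
  congr 1
  ext x
  simp

lemma sum_prod_bool {n : ℕ} (P : Fin n → Bool → Prop) [∀ i, DecidablePred (P i)]
    (m : Fin n → Bool → ℝ) :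
    (∑ z ∈ Finset.univ.filter fun z : Fin n → Bool => ∀ i, P i (z i), ∏ i, m i (z i)) =
      ∏ i, ∑ y ∈ Finset.univ.filter fun y => P i y, m i y := by
  rw [Finset.prod_univ_sum]
  refine Finset.sum_congr ?_ fun _ _ => rfl
  ext z
  simp

/-- The law at time `t` of the hit word, a product of Bernoulli laws. -/
lemma tsum_poisson_hitWord [Fintype C] (S : DartboardSketch C) {n : ℕ} (c : Fin n ≃ C) (t : ℝ)
    (z : Fin n → Bool) :
    ∑' k : ℕ, Real.exp (-t) * t ^ k / (k.factorial : ℝ) *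
      volume.real {x : Fin k → Dartboard | S.hitWord c x = z} =
    ∏ i, if z i then 1 - Real.exp (-S.cellArea (c i) * t)
      else Real.exp (-S.cellArea (c i) * t) := by
  classical
  refine congrFun (eq_of_sum_le_eq (f := fun z => ∑' k : ℕ, Real.exp (-t) * t ^ k /
    (k.factorial : ℝ) * volume.real {x : Fin k → Dartboard | S.hitWord c x = z})
    (g := fun z => ∏ i, if z i then 1 - Real.exp (-S.cellArea (c i) * t)
      else Real.exp (-S.cellArea (c i) * t)) fun b => ?_) z
  have e1 := sum_prod_bool (fun i y => y ≤ b i) fun i y =>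
    if y then 1 - Real.exp (-S.cellArea (c i) * t) else Real.exp (-S.cellArea (c i) * t)
  have e2 : ∀ i, (∑ y with y ≤ b i, if y then 1 - Real.exp (-S.cellArea (c i) * t)
      else Real.exp (-S.cellArea (c i) * t)) =
      if b i = false then Real.exp (-S.cellArea (c i) * t) else 1 := by
    intro i
    rw [Finset.sum_filter]
    cases b i <;> simp
  rw [S.sum_tsum_poisson_hitWord]
  simp only [Pi.le_def]
  rw [e1, Finset.prod_congr rfl fun i _ => e2 i, ← Finset.prod_filter, ← Real.exp_sum]
  simp only [Finset.mem_filter, Finset.mem_univ, true_and]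
  simp only [← Pi.le_def, S.volume_hitWord_le]
  set s := ∑ i with b i = false, S.cellArea (c i) with hs
  have e3 : ∀ k : ℕ, Real.exp (-t) * t ^ k / (k.factorial : ℝ) * (1 - s) ^ k =
      Real.exp (-t) * ((t * (1 - s)) ^ k / (k.factorial : ℝ)) := fun k => by
    rw [mul_pow]
    ring
  simp_rw [e3]
  -- Poissonization turns the powers `(1 - s) ^ k` into `exp (-s * t)`, which factors over cells.
  have e4 := congrFun NormedSpace.exp_eq_tsum_div (t * (1 - s))
  rw [← Real.exp_eq_exp_ℝ] at e4
  rw [tsum_mul_left, ← e4, ← Real.exp_add, ← Finset.sum_mul, Finset.sum_neg_distrib, ← hs]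
  congr 1
  ring

end DartboardSketch

lemma wordProb_eq_prod (φ : (i : ℕ) → (Fin i → Bool) → Bool) (q : ℕ → ℝ) (n : ℕ)
    (y : Fin n → Bool) :
    wordProb φ q n y = ∏ i : Fin n, bitProb (q i) (φ i fun j => y (j.castLE i.isLt.le)) (y i) := by
  induction n with
  | zero => simp [wordProb]
  | succ n ih =>
    rw [Fin.prod_univ_castSucc, wordProb, ih]
    rfl

namespace DartboardSketch

variable {C : Type*}

/-- The area of the `i`-th cell in an enumeration, extended by zero. -/
noncomputable def areaSeq (S : DartboardSketch C) {n : ℕ} (c : Fin n → C) (i : ℕ) : ℝ :=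
  if h : i < n then S.cellArea (c ⟨i, h⟩) else 0

lemma areaSeq_nonneg (S : DartboardSketch C) {n : ℕ} (c : Fin n → C) (i : ℕ) :
    0 ≤ S.areaSeq c i := by
  unfold areaSeq
  split_ifs
  · exact measureReal_nonneg
  · exact le_rfl

open scoped Classical in
/-- The word of a state with respect to an enumeration of the cells. -/
noncomputable def stateWord [Fintype C] (c : Fin (Fintype.card C) ≃ C) :
    Finset C ≃ (Fin (Fintype.card C) → Bool) where
  toFun σ i := decide (c i ∈ σ)
  invFun y := Finset.univ.filter fun a => y (c.symm a) = true
  left_inv σ := by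
    ext a
    simp
  right_inv y := by
    ext i
    simp

/-- The law of the state of a linearizable sketch. -/
lemma stateProb_eq_wordProb [Fintype C] (S : DartboardSketch C) (c : Fin (Fintype.card C) ≃ C)
    (φ : (i : ℕ) → (Fin i → Bool) → Bool)
    (h : ∀ (k : ℕ) (x : Fin k → Dartboard) (i : Fin (Fintype.card C)),
      c i ∈ S.stateAfter x ↔ (∃ j, S.cellOf (x j) = c i) ∨
        φ i (fun j => stateWord c (S.stateAfter x) (j.castLE i.isLt.le)) = true)
    (t : ℝ) (σ : Finset C) :
    S.stateProb t σ =
      wordProb φ (fun i => Real.exp (-S.areaSeq c i * t)) _ (stateWord c σ) := by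
  classical
  set y := stateWord c σ with hy
  -- The hit words compatible with the state word `y`. Membership is a condition on each bit
  -- separately, so the product law factors over `A`.
  set A : Finset (Fin (Fintype.card C) → Bool) := Finset.univ.filter fun z =>
    ∀ i, y i = (z i || φ i (fun j => y (j.castLE i.isLt.le))) with hA
  have hrec : ∀ (k : ℕ) (x : Fin k → Dartboard) (i : Fin (Fintype.card C)),
      stateWord c (S.stateAfter x) i = (S.hitWord c x i ||
        φ i (fun j => stateWord c (S.stateAfter x) (j.castLE i.isLt.le))) := by
    intro k x i
    rw [Bool.eq_iff_iff, Bool.or_eq_true, hitWord, decide_eq_true_iff, ← h]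
    simp [stateWord]
  have hset : ∀ k : ℕ, {x : Fin k → Dartboard | S.stateAfter x = σ} =
      {x | S.hitWord c x ∈ A} := by
    intro k
    ext x
    simp only [mem_ofPred_eq, hA, Finset.mem_filter, Finset.mem_univ, true_and]
    constructor
    · intro hx i
      have := hrec k x i
      rwa [hx] at this
    · intro hx
      apply (stateWord c).injective
      -- The recursion determines the state word from the hit word, bit by bit.
      have key : ∀ (m : ℕ) (hm : m < Fintype.card C),
          stateWord c (S.stateAfter x) ⟨m, hm⟩ = y ⟨m, hm⟩ := by
        intro m
        induction m using Nat.strong_induction_on with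
        | _ m ih =>
          intro hm
          rw [hrec, hx]
          congr 2
          ext j
          exact ih j j.isLt _
      ext i
      exact key i i.isLt
  unfold stateProb
  simp_rw [hset]
  rw [wordProb_eq_prod]
  refine (S.sum_tsum_poisson_hitWord c t A).symm.trans ?_
  rw [Finset.sum_congr rfl fun z _ => S.tsum_poisson_hitWord c t z, hA]
  rw [sum_prod_bool (fun i b => y i = (b || φ i (fun j => y (j.castLE i.isLt.le)))) fun i b =>
    if b then 1 - Real.exp (-S.cellArea (c i) * t) else Real.exp (-S.cellArea (c i) * t)]
  refine Finset.prod_congr rfl fun i _ => ?_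
  rw [Finset.sum_filter, Fintype.sum_bool]
  have ha : S.areaSeq c i = S.cellArea (c i) := by simp [areaSeq]
  rw [ha]
  unfold bitProb
  cases y i <;> cases φ i (fun j => y (j.castLE i.isLt.le)) <;> simp

end DartboardSketch

/-! ### Summation over cells and integration over logarithmic time -/

namespace DartboardSketch

variable {C : Type*} [Fintype C]

/-- Entropy of the state of a linearizable sketch, cell by cell. -/
lemma shannonEntropy_eq (S : DartboardSketch C) (c : Fin (Fintype.card C) ≃ C)
    (φ : (i : ℕ) → (Fin i → Bool) → Bool) {q : ℕ → ℝ} {t : ℝ}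
    (h : ∀ σ, S.stateProb t σ = wordProb φ q _ (stateWord c σ)) :
    shannonEntropy (S.stateProb t) =
      (∑ i ∈ Finset.range (Fintype.card C), freeProb φ q i * hNat (q i)) / Real.log 2 := by
  rw [← sum_negMulLog_wordProb, ← (stateWord c).sum_comp, shannonEntropy, Finset.sum_div]
  refine Finset.sum_congr rfl fun σ _ => ?_
  rw [h, Real.logb, Real.negMulLog]
  ring

/-- Fisher information of the state of a linearizable sketch, cell by cell. -/
lemma fisherInformation_eq (S : DartboardSketch C) (c : Fin (Fintype.card C) ≃ C)
    (φ : (i : ℕ) → (Fin i → Bool) → Bool) {p : ℕ → ℝ} (hp : ∀ i, 0 ≤ p i)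
    (h : ∀ t σ, S.stateProb t σ = wordProb φ (fun i => Real.exp (-p i * t)) _ (stateWord c σ))
    {t : ℝ} (ht : 0 < t) :
    fisherInformation S.stateProb t = ∑ i ∈ Finset.range (Fintype.card C),
      freeProb φ (fun i => Real.exp (-p i * t)) i * (p i ^ 2 / (Real.exp (p i * t) - 1)) := by
  rw [← fisherInformation_wordProb φ ht hp, fisherInformation, fisherInformation,
    ← (stateWord c).sum_comp]
  refine Finset.sum_congr rfl fun σ _ => ?_
  simp only [h]

/-- Averaged comparison of Fisher information and entropy over logarithmic time. -/
lemma fisher_le_entropy (S : DartboardSketch C) (hS : S.IsLinearizable) {a b D Hmax Imin : ℝ}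
    (hab : a ≤ b) (hD : 2048 ≤ D) (hD' : 6 * Real.exp (-D / 4) ≤ 1)
    (hH : ∀ t : ℝ, 0 < t → shannonEntropy (S.stateProb t) ≤ Hmax)
    (hI : ∀ t ∈ Icc (Real.exp a) (Real.exp b), Imin ≤ t ^ 2 * fisherInformation S.stateProb t) :
    (1 - 6 * Real.exp (-D / 4)) * (H₀ / I₀) * ((b - a) * Imin) ≤ (b - a + D) * Hmax := by
  obtain ⟨c, φ, hφ, hlin⟩ := hS
  set p := S.areaSeq c with hp
  have hp0 : ∀ i, 0 ≤ p i := S.areaSeq_nonneg c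
  have hlaw : ∀ t σ, S.stateProb t σ =
      wordProb φ (fun i => Real.exp (-p i * t)) _ (stateWord c σ) :=
    S.stateProb_eq_wordProb c φ hlin
  set k : ℕ → ℝ → ℝ := fun i x => freeProb φ (fun i => Real.exp (-p i * Real.exp x)) i with hk
  have hkc : ∀ i, Continuous (k i) := fun i => (continuous_freeProb φ p i).comp Real.continuous_exp
  have hq0 : ∀ x i, 0 ≤ Real.exp (-p i * Real.exp x) := fun x i => (Real.exp_pos _).le
  have hq1 : ∀ x i, Real.exp (-p i * Real.exp x) ≤ 1 := fun x i => by
    rw [Real.exp_le_one_iff]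
    have := mul_nonneg (hp0 i) (Real.exp_pos x).le
    linarith
  have hk0 : ∀ i x, 0 ≤ k i x := fun i x => freeProb_nonneg φ (hq0 x) (hq1 x) i
  have hka : ∀ i, Antitone (k i) := fun i x y hxy =>
    freeProb_le_of_le φ hφ (hq0 y) (fun j => by
      rw [Real.exp_le_exp]
      have := mul_le_mul_of_nonneg_left (Real.exp_le_exp.2 hxy) (hp0 j)
      linarith) (hq1 x) i
  set α := (1 - 6 * Real.exp (-D / 4)) * ((∫ w, entropyDensity w) / ∫ w, fisherDensity w) with hα
  set η : ℕ → ℝ → ℝ := fun i x => hNat (Real.exp (-p i * Real.exp x)) with hη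
  set γ : ℕ → ℝ → ℝ := fun i x =>
    Real.exp x ^ 2 * (p i ^ 2 / (Real.exp (p i * Real.exp x) - 1)) with hγ
  -- In logarithmic time a cell of positive area is a translate by the logarithm of its area; a null
  -- cell contributes zero to both sums.
  have hcell : ∀ i, (p i = 0 ∧ (∀ x, η i x = 0) ∧ ∀ x, γ i x = 0) ∨
      ∃ w, (∀ x, η i x = entropyDensity (x + w)) ∧ ∀ x, γ i x = fisherDensity (x + w) := by
    intro i
    rcases (hp0 i).eq_or_lt with h | h
    · left
      simp [hη, hγ, ← h, hNat]
    · right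
      refine ⟨Real.log (p i), fun x => ?_, fun x => ?_⟩
      · simp only [hη, entropyDensity, Real.exp_add, Real.exp_log h]
        ring_nf
      · simp only [hγ, fisherDensity, Real.exp_add, Real.exp_log h, ← mul_div_assoc, mul_pow,
          mul_comm (p i)]
  have hηc : ∀ i, Continuous (η i) := by
    intro i
    rcases hcell i with ⟨-, h, -⟩ | ⟨w, h, -⟩
    · rw [funext h]
      exact continuous_const
    · rw [funext h]
      exact continuous_entropyDensity.comp (continuous_add_const w)
  have hγc : ∀ i, Continuous (γ i) := by
    intro i
    rcases hcell i with ⟨-, -, h⟩ | ⟨w, -, h⟩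
    · rw [funext h]
      exact continuous_const
    · rw [funext h]
      exact continuous_fisherDensity.comp (continuous_add_const w)
  have hterm : ∀ i, α * ∫ x in a..b, k i x * γ i x ≤ ∫ x in (a - D)..b, k i x * η i x := by
    intro i
    rcases hcell i with ⟨-, h, h'⟩ | ⟨w, h, h'⟩
    · simp [h, h']
    · simp only [h, h']
      exact integral_weighted_fisherDensity_le (hka i) (hk0 i) (hkc i) hab hD hD' w
  have hα0 : 0 ≤ α := by
    have := one_le_integral_entropyDensity
    have := one_le_integral_fisherDensity
    have : 0 ≤ 1 - 6 * Real.exp (-D / 4) := by linarith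
    positivity
  have hlog : 0 < Real.log 2 := Real.log_pos one_lt_two
  have hfish : (b - a) * Imin ≤ ∑ i ∈ Finset.range (Fintype.card C), ∫ x in a..b, k i x * γ i x := by
    rw [← intervalIntegral.integral_finsetSum (f := fun i x => k i x * γ i x) fun i _ =>
      ((hkc i).mul (hγc i)).intervalIntegrable _ _]
    have h1 : ∫ _ in a..b, Imin = (b - a) * Imin := by simp
    rw [← h1]
    refine intervalIntegral.integral_mono_on hab (by simp)
      ((continuous_finsetSum _ fun i _ => (hkc i).mul (hγc i)).intervalIntegrable _ _) ?_
    intro x hx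
    refine (hI (Real.exp x) ⟨Real.exp_le_exp.2 hx.1, Real.exp_le_exp.2 hx.2⟩).trans (le_of_eq ?_)
    rw [S.fisherInformation_eq c φ hp0 hlaw (Real.exp_pos x), Finset.mul_sum]
    refine Finset.sum_congr rfl fun i _ => ?_
    simp only [hk, hγ]
    ring
  -- The entropy bound holds at all times, so it may be integrated over the longer window starting
  -- at `a - D`.
  have hent : ∑ i ∈ Finset.range (Fintype.card C), ∫ x in (a - D)..b, k i x * η i x ≤
      (b - a + D) * (Hmax * Real.log 2) := by
    rw [← intervalIntegral.integral_finsetSum (f := fun i x => k i x * η i x) fun i _ =>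
      ((hkc i).mul (hηc i)).intervalIntegrable _ _]
    have h1 : ∫ _ in (a - D)..b, Hmax * Real.log 2 = (b - a + D) * (Hmax * Real.log 2) := by
      simp
      ring
    rw [← h1]
    refine intervalIntegral.integral_mono_on (by linarith)
      ((continuous_finsetSum _ fun i _ => (hkc i).mul (hηc i)).intervalIntegrable _ _)
      (by simp) ?_
    intro x hx
    have h2 := hH (Real.exp x) (Real.exp_pos x)
    rwa [S.shannonEntropy_eq c φ (hlaw (Real.exp x)), div_le_iff₀ hlog] at h2
  have hfin : α * ((b - a) * Imin) ≤ (b - a + D) * (Hmax * Real.log 2) := by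
    calc α * ((b - a) * Imin) ≤ α * ∑ i ∈ Finset.range (Fintype.card C), ∫ x in a..b, k i x * γ i x := by
          gcongr
      _ ≤ ∑ i ∈ Finset.range (Fintype.card C), ∫ x in (a - D)..b, k i x * η i x := by
          rw [Finset.mul_sum]
          exact Finset.sum_le_sum fun i _ => hterm i
      _ ≤ _ := hent
  have e : H₀ / I₀ = ((∫ w, entropyDensity w) / ∫ w, fisherDensity w) / Real.log 2 := by
    simp only [H₀, I₀, entropyDensity, fisherDensity]
    ring
  rw [e, ← mul_div_assoc, ← hα, div_mul_eq_mul_div, div_le_iff₀ hlog]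
  linarith

end DartboardSketch

/-! ### Asymptotics of the loss and conclusion -/

lemma H₀_div_I₀_pos : 0 < H₀ / I₀ := by
  have h1 : 0 < ∫ w, entropyDensity w := by linarith [one_le_integral_entropyDensity]
  have h2 : 0 < ∫ w, fisherDensity w := by linarith [one_le_integral_fisherDensity]
  have h3 : 0 < Real.log 2 := Real.log_pos one_lt_two
  have : H₀ / I₀ = (1 / Real.log 2 * ∫ w, entropyDensity w) / ∫ w, fisherDensity w := rfl
  rw [this]
  positivity

lemma tendsto_lossFactor : Tendsto lossFactor atTop (𝓝 1) := by
  have h1 : Tendsto (fun d : ℝ => 8 * d ^ (-(1 / 4) : ℝ)) atTop (𝓝 (8 * 0)) :=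
    (tendsto_rpow_neg_atTop (by norm_num)).const_mul 8
  have h2 : Tendsto (fun d : ℝ => 5 * Real.exp (-d / 2)) atTop (𝓝 (5 * 0)) := by
    refine Tendsto.const_mul 5 (Real.tendsto_exp_atBot.comp ?_)
    exact (tendsto_neg_atTop_atBot).atBot_div_const two_pos
  have h3 := (h1.max h2).const_sub 1
  simp only [mul_zero, max_self, sub_zero] at h3
  exact h3

lemma tendsto_lossDenominator : Tendsto lossDenominator atTop (𝓝 1) := by
  have h1 : Tendsto (fun d : ℝ => (344 + 4 * Real.sqrt d) / d) atTop (𝓝 (344 * 0 + 4 * 0)) := by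
    have h2 : Tendsto (fun d : ℝ => 344 * d⁻¹ + 4 * (Real.sqrt d)⁻¹) atTop
        (𝓝 (344 * 0 + 4 * 0)) :=
      (tendsto_inv_atTop_zero.const_mul 344).add
        ((tendsto_inv_atTop_zero.comp Real.tendsto_sqrt_atTop).const_mul 4)
    refine h2.congr' ?_
    filter_upwards [eventually_gt_atTop 0] with d hd
    rw [add_div, div_eq_mul_inv, mul_div_assoc, Real.sqrt_div_self]
  have := ((h1.mul_const (H₀ / I₀)).mul tendsto_lossFactor).const_add 1
  simp only [mul_zero, add_zero, zero_mul] at this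
  exact this

lemma one_le_lossDenominator {d : ℝ} (hd : 0 < d) (h : 0 ≤ lossFactor d) :
    1 ≤ lossDenominator d := by
  have := H₀_div_I₀_pos
  unfold lossDenominator
  have : 0 ≤ (344 + 4 * Real.sqrt d) / d * (H₀ / I₀) * lossFactor d := by positivity
  linarith

/-- Only the first term of the maximum matters. With `s = d ^ (1 / 4)`, positivity forces `s > 8`,
hence `4 * s ^ 3 ≥ 2048`; this is the threshold assumed for `D` above. The product `(1 - 8 / s) * (s
^ 4 + 4 * s ^ 3)` is at most `s ^ 4 - 4 * s ^ 3`, leaving room for the exponential error. -/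
lemma lossFactor_mul_le {d : ℝ} (hd : 0 < d) (h : 0 < lossFactor d) :
    2048 ≤ 4 * d ^ (3 / 4 : ℝ) ∧ 6 * Real.exp (-(4 * d ^ (3 / 4 : ℝ)) / 4) ≤ 1 ∧
    lossFactor d * (d + 4 * d ^ (3 / 4 : ℝ)) ≤
      (1 - 6 * Real.exp (-(4 * d ^ (3 / 4 : ℝ)) / 4)) * d := by
  set s := d ^ (1 / 4 : ℝ) with hs
  have hs0 : 0 < s := Real.rpow_pos_of_pos hd _
  have e1 : d ^ (-(1 / 4) : ℝ) = s⁻¹ := Real.rpow_neg hd.le _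
  have e2 : d ^ (3 / 4 : ℝ) = s ^ 3 := by
    rw [hs, ← Real.rpow_natCast, ← Real.rpow_mul hd.le]
    norm_num
  have e3 : d = s ^ 4 := by
    rw [hs, ← Real.rpow_natCast, ← Real.rpow_mul hd.le]
    norm_num
  have hL : lossFactor d ≤ 1 - 8 * s⁻¹ := by
    unfold lossFactor
    rw [e1]
    linarith [le_max_left (8 * s⁻¹) (5 * Real.exp (-d / 2))]
  have hs8 : 8 < s := by
    have : 8 * s⁻¹ < 1 := by linarith
    rwa [← div_eq_mul_inv, div_lt_one hs0] at this
  rw [e2]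
  have hs2 : 64 ≤ s ^ 2 := by nlinarith
  have hs3 : 64 * s ≤ s ^ 3 := by nlinarith
  have hs512 : 512 ≤ s ^ 3 := by linarith
  have hexp : Real.exp (-(4 * s ^ 3) / 4) ≤ s⁻¹ / 6 := by
    rw [show -(4 * s ^ 3) / 4 = -s ^ 3 by ring, Real.exp_neg, div_eq_mul_inv, ← mul_inv]
    gcongr
    linarith [Real.add_one_le_exp (s ^ 3)]
  have hsi : s⁻¹ ≤ 1 := inv_le_one_of_one_le₀ (by linarith)
  refine ⟨by linarith, by linarith, ?_⟩
  have hs3i : s⁻¹ * s ^ 4 = s ^ 3 := by field_simp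
  calc lossFactor d * (d + 4 * s ^ 3) ≤ (1 - 8 * s⁻¹) * (d + 4 * s ^ 3) := by
        gcongr
    _ ≤ (1 - s⁻¹) * d := by
        rw [e3]
        have : 0 ≤ s⁻¹ * s ^ 3 := by positivity
        nlinarith
    _ ≤ _ := by
        gcongr
        linarith

theorem theorem5p5 :
    (∀ {C : Type*} [Fintype C] (S : DartboardSketch C) (_ : S.IsLinearizable)
        (a b Hmax Imin : ℝ) (_ : 1 < b - a) (_ : 0 < Hmax) (_ : 0 < Imin)
        (_ : 0 < lossDenominator (b - a))
        (_ : ∀ t : ℝ, 0 < t → shannonEntropy (S.stateProb t) ≤ Hmax)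
        (_ : ∀ t ∈ Set.Icc (Real.exp a) (Real.exp b),
          Imin ≤ t ^ 2 * fisherInformation S.stateProb t),
        H₀ / I₀ * (lossFactor (b - a) / lossDenominator (b - a)) ≤ Hmax / Imin) ∧
    (∃ ε : ℝ → ℝ, Filter.Tendsto ε Filter.atTop (nhds 0) ∧
      ∀ d : ℝ, 1 < d →
        H₀ / I₀ * (lossFactor d / lossDenominator d) = (1 - ε d) * (H₀ / I₀)) := by
  refine ⟨?_, fun d => 1 - lossFactor d / lossDenominator d, ?_, fun d _ => by ring⟩
  · intro C _ S hS a b Hmax Imin hab hH0 hI0 hden hH hI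
    have hr := H₀_div_I₀_pos
    -- A nonpositive loss factor makes the left side nonpositive, so the claim is trivial.
    rcases le_or_gt (lossFactor (b - a)) 0 with h | h
    · exact (mul_nonpos_of_nonneg_of_nonpos hr.le (div_nonpos_of_nonpos_of_nonneg h hden.le)).trans
        (by positivity)
    · have hd : 0 < b - a := by linarith
      obtain ⟨h1, h2, h3⟩ := lossFactor_mul_le hd h
      have hmain := S.fisher_le_entropy hS (by linarith : a ≤ b) h1 h2 hH hI
      set D := 4 * (b - a) ^ (3 / 4 : ℝ)
      have hle : lossFactor (b - a) / lossDenominator (b - a) ≤ lossFactor (b - a) :=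
        div_le_self h.le (one_le_lossDenominator hd h.le)
      refine (mul_le_mul_of_nonneg_left hle hr.le).trans ?_
      rw [le_div_iff₀ hI0]
      have hpos : 0 < b - a + D := by linarith
      refine le_of_mul_le_mul_left ?_ hpos
      refine le_trans ?_ hmain
      have := mul_le_mul_of_nonneg_left h3 (mul_pos hr hI0).le
      linarith
  · simpa using (tendsto_lossFactor.div tendsto_lossDenominator one_ne_zero).const_sub 1
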